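/- Let $K$ be a field and let $n_1<n_2<n_3<n_4$ be positive integers with $\gcd(n_1,n_2,n_3,n_4)=1$. Let $I(C)\subset K[x_1,x_2,x_3,x_4]$ be the toric ideal of the monomial curve $C$, that is, the kernel of the $K$-algebra homomorphism $K[x_1,\dots,x_4]\to K[t]$, $x_i\mapsto t^{n_i}$. For a polynomial $f$ let $f_*$ be its homogeneous summand of least degree, and let $I(C)_*$ be the ideal generated by all $f_*$ with $f\in I(C)$. Suppose that $I(C)$ is given as in case 3(b), that is, there are integers with $0<a_{ij}<a_j$ for $ij\in\{12,14,23,24,31,32,41,43\}$ such that $I(C)$ is minimally generated by $$f_1=x_1^{a_1}-x_2^{a_{12}}x_4^{a_{14}},\quad f_2=x_2^{a_2}-x_3^{a_{23}}x_4^{a_{24}},\quad f_3=x_3^{a_3}-x_1^{a_{31}}x_2^{a_{32}},$$ $$f_4=x_4^{a_4}-x_1^{a_{41}}x_3^{a_{43}},\quad f_5=x_1^{a_{31}}x_4^{a_{24}}-x_2^{a_{12}}x_3^{a_{43}}.$$ Assume that $a_{31}+a_{24}<a_{12}+a_{43}$, $a_{14}\le a_{24}$ and $a_2+a_{12}\le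 a_1+a_{23}+a_{24}-a_{14}$. Put $$f_6=x_2^{a_2+a_{12}}-x_1^{a_1}x_3^{a_{23}}x_4^{a_{24}-a_{14}},\qquad f_7=x_1^{a_1+a_{31}}x_4^{a_{24}-a_{14}}-x_2^{2a_{12}}x_3^{a_{43}}.$$ Then $\{f_1,\dots,f_7\}$ is a standard basis of $I(C)$ with respect to the negative degree reverse lexicographic ordering with $x_4>x_3>x_2>x_1$: it is contained in $I(C)$, and the leading monomial of every nonzero element of $I(C)$ is divisible by the leading monomial of some $f_i$. Moreover: 1. If $a_2+a_{12}<a_1+a_{23}+a_{24}-a_{14}$, then $I(C)_*$ is minimally generated by $$\{x_2^{a_{12}}x_4^{a_{14}},\ x_3^{a_{23}}x_4^{a_{24}},\ x_3^{a_3},\ x_4^{a_4},\ x_1^{a_{31}}x_4^{a_{24}},\ x_2^{a_2+a_{12}},\ x_2^{2a_{12}}x_3^{a_{43}}\}.$$ 2. If $a_2+a_{12}=a_1+a_{23}+a_{24}-a_{14}$, then $I(C)_*$ is minimally generated by $$\{x_2^{a_{12}}x_4^{a_{14}},\ x_3^{a_{23}}x_4^{a_{24}},\ x_3^{a_3},\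 x_4^{a_4},\ x_1^{a_{31}}x_4^{a_{24}},\ x_2^{a_2+a_{12}}-x_1^{a_1}x_3^{a_{23}}x_4^{a_{24}-a_{14}},\ x_2^{2a_{12}}x_3^{a_{43}}\}.$$ In both cases the minimal number of generators of $I(C)_*$ is $7$. -/

import Mathlib

open MvPolynomial

noncomputable section

namespace MonomialCurve

variable {d : ℕ} {K : Type*} [Field K]

/-- The toric ideal `I(C)` of the monomial curve `x_i = t ^ (n i)`: the kernel of the
`K`-algebra homomorphism `K[x] → K[t]` sending `x_i` to `t ^ (n i)`. -/
def toricIdeal (K : Type*) [Field K] (n : Fin d → ℕ) : Ideal (MvPolynomial (Fin d) K) :=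
  RingHom.ker
    (aeval (fun i => (Polynomial.X : Polynomial K) ^ n i) :
      MvPolynomial (Fin d) K →ₐ[K] Polynomial K)

/-- The least degree of a monomial occurring in `f` (and `0` for `f = 0`). -/
def leastDegree (f : MvPolynomial (Fin d) K) : ℕ :=
  sInf {k | ∃ α ∈ f.support, α.degree = k}

/-- `f_*`, the homogeneous summand of `f` of least degree. -/
def leastForm (f : MvPolynomial (Fin d) K) : MvPolynomial (Fin d) K :=
  homogeneousComponent (leastDegree f) f

/-- `I_*`, the ideal generated by the least homogeneous summands of the elements of `I`. -/
def tangentConeIdeal (I : Ideal (MvPolynomial (Fin d) K)) : Ideal (MvPolynomial (Fin d) K) :=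
  Ideal.span (leastForm '' (I : Set (MvPolynomial (Fin d) K)))

/-- `S` is a minimal generating set of `I`: it generates `I`, and it stops doing so when any
one of its elements is left out. -/
def IsMinimallyGeneratedBy {R : Type*} [CommRing R] (I : Ideal R) (S : Set R) : Prop :=
  Ideal.span S = I ∧ ∀ g ∈ S, Ideal.span (S \ {g}) ≠ I

/-- The negative degree reverse lexicographic ordering with the variable of largest index
largest (`x_d > ⋯ > x_1`): `NegDegRevLexGT α β` says `x ^ α > x ^ β`. Lower total degree is larger;
among monomials of equal degree the exponents are compared starting from the smallest variable
(that of least index), and the one with the smaller exponent there is larger. -/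
def NegDegRevLexGT (α β : Fin d →₀ ℕ) : Prop :=
  α.degree < β.degree ∨
    (α.degree = β.degree ∧ ∃ i, (∀ j, j < i → α j = β j) ∧ α i < β i)

/-- `x ^ α` is the leading monomial of `f` for this ordering. -/
def IsLeadingExponent (f : MvPolynomial (Fin d) K) (α : Fin d →₀ ℕ) : Prop :=
  α ∈ f.support ∧ ∀ β ∈ f.support, β ≠ α → NegDegRevLexGT α β

/-- `G` is a standard basis of `I` for the negative degree reverse lexicographic ordering: a finite
subset of `I` such that the leading monomial of each nonzero element of `I` is divisible by
the leading monomial of an element of `G`. -/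
def IsStandardBasis (G : Set (MvPolynomial (Fin d) K)) (I : Ideal (MvPolynomial (Fin d) K)) :
    Prop :=
  G.Finite ∧ (∀ g ∈ G, g ∈ I) ∧
    ∀ f ∈ I, f ≠ 0 →
      ∃ g ∈ G, ∃ α β, IsLeadingExponent f α ∧ IsLeadingExponent g β ∧ β ≤ α

end MonomialCurve

end

/-! The proof replaces Buchberger–Mora computations by rewriting of exponents. Each of the seven
binomials is read as a rule, leading monomial → trailing monomial. A rule preserves the weight `∑ α
i * n i` and raises the degree or, at equal degree, the exponent of `x_1`. The weight bounds both
quantities, so rewriting terminates. Each of the 21 critical pairs closes with at most one step on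
either side. The last two binomials make this possible: they complete the critical pairs of `f_1`
with `f_2` and of `f_1` with `f_5`. Hence normal forms are unique (`strongly_confluent`).

Extended linearly, the normal form kills `I(C)`, because `f_1, …, f_5` already generate it
(`normalFormMap_eq_zero`). An irreducible leading monomial would survive in the normal form, which
gives the standard basis. Moreover `f` is a sum of differences `c (x ^ α - x ^ nf α)`. Telescoping
these along the rewriting paths puts the least form of `f` into the ideal of the seven initial forms
(`tangentConeIdeal_eq`).

The leading monomials form an antichain, so their coefficients separate the initial forms. This
yields minimality and, by a Nakayama-type argument, the number seven.

The required degree inequalities follow from `n_1 < n_2 < n_3 < n_4`, the hypotheses, and the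
relations `a_1 = a_31 + a_41`, etc. (`exponent_relations`). -/

namespace MonomialCurve

open Relation

/-! ### Rewriting of exponents: termination and confluence -/

/-- `x ^ β` arises from `x ^ α` by replacing a factor `x ^ l i` by `x ^ t i`. -/
def RewriteStep {ι σ : Type*} (l t : ι → σ →₀ ℕ) (α β : σ →₀ ℕ) : Prop :=
  ∃ i q, α = q + l i ∧ β = q + t i

/-- The lexicographic order on total degree and one exponent. -/
def DegreeThenExponentLT {σ : Type*} (s : σ) (α β : σ →₀ ℕ) : Prop :=
  α.degree < β.degree ∨ (α.degree = β.degree ∧ α s < β s)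

section Rewriting

variable {ι σ : Type*} {l t : ι → σ →₀ ℕ} {s : σ}

theorem DegreeThenExponentLT.add_left {α β : σ →₀ ℕ} (h : DegreeThenExponentLT s α β)
    (q : σ →₀ ℕ) : DegreeThenExponentLT s (q + α) (q + β) := by
  simp only [DegreeThenExponentLT, map_add, Finsupp.add_apply] at h ⊢
  omega

theorem DegreeThenExponentLT.trans {α β γ : σ →₀ ℕ} (h : DegreeThenExponentLT s α β)
    (h' : DegreeThenExponentLT s β γ) : DegreeThenExponentLT s α γ := by
  simp only [DegreeThenExponentLT] at h h' ⊢
  omega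

theorem RewriteStep.degreeThenExponentLT (hlt : ∀ i, DegreeThenExponentLT s (l i) (t i))
    {α β : σ →₀ ℕ} (h : RewriteStep l t α β) : DegreeThenExponentLT s α β := by
  obtain ⟨i, q, rfl, rfl⟩ := h
  exact (hlt i).add_left q

theorem eq_or_degreeThenExponentLT_of_reflTransGen
    (hlt : ∀ i, DegreeThenExponentLT s (l i) (t i)) {α β : σ →₀ ℕ}
    (h : ReflTransGen (RewriteStep l t) α β) : α = β ∨ DegreeThenExponentLT s α β := by
  induction h with
  | refl => exact .inl rfl
  | tail _ h ih =>
    have h := h.degreeThenExponentLT hlt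
    rcases ih with rfl | ih
    · exact .inr h
    · exact .inr (ih.trans h)

theorem eq_of_reflTransGen_of_irreducible {α β : σ →₀ ℕ} (hα : ∀ i, ¬ l i ≤ α)
    (h : ReflTransGen (RewriteStep l t) α β) : α = β := by
  rcases h.cases_head with h | ⟨γ, ⟨i, q, rfl, -⟩, -⟩
  · exact h
  · exact absurd le_add_self (hα i)

/-- Rewriting that preserves a positive weight and increases the degree (or keeps it and increases
one exponent) leads to an irreducible exponent. -/
theorem exists_irreducible_reflTransGen (w : (σ →₀ ℕ) →+ ℕ) (hw : ∀ α : σ →₀ ℕ, α.degree ≤ w α)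
    (hlt : ∀ i, DegreeThenExponentLT s (l i) (t i)) (hwt : ∀ i, w (l i) = w (t i))
    (α : σ →₀ ℕ) :
    ∃ ν, ReflTransGen (RewriteStep l t) α ν ∧ ∀ i, ¬ l i ≤ ν := by
  have hwf : WellFounded (fun x y : ℕ × ℕ => Prod.Lex (· < ·) (· < ·) x y) :=
    WellFounded.prod_lex wellFounded_lt wellFounded_lt
  -- The weight `w` is constant along rewriting and bounds the degree and the exponent at `s`, so
  -- both differences are true subtractions and the pair drops lexicographically.
  have key := InvImage.wf (fun β : σ →₀ ℕ => (w β - β.degree, w β - β s)) hwf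
  induction α using key.induction with
  | _ α ih =>
  by_cases h : ∃ i, l i ≤ α
  · obtain ⟨i, hi⟩ := h
    have hstep : RewriteStep l t α (α - l i + t i) := ⟨i, α - l i, by
      rw [tsub_add_cancel_of_le hi], rfl⟩
    have hd := hstep.degreeThenExponentLT hlt
    have hW : w (α - l i + t i) = w α := by
      rw [map_add, ← hwt, ← map_add, tsub_add_cancel_of_le hi]
    have h1 := hw (α - l i + t i)
    have h2 := Finsupp.le_degree s (α - l i + t i)
    obtain ⟨ν, hν, hirr⟩ := ih (α - l i + t i) (by
      simp only [InvImage, Prod.lex_def]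
      rw [hW] at h1 ⊢
      rcases hd with hd | ⟨hd, hd'⟩
      · left; omega
      · right; omega)
    exact ⟨ν, .head hstep hν, hirr⟩
  · exact ⟨α, .refl, not_exists.mp h⟩

/-- A function choosing irreducible representatives is constant along confluent rewriting. -/
theorem normalForm_eq_of_rewriteStep
    (hconf : ∀ a b c, RewriteStep l t a b → RewriteStep l t a c →
      ∃ d, ReflGen (RewriteStep l t) b d ∧ ReflTransGen (RewriteStep l t) c d)
    {nf : (σ →₀ ℕ) → σ →₀ ℕ} (hnf : ∀ α, ReflTransGen (RewriteStep l t) α (nf α))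
    (hirr : ∀ α i, ¬ l i ≤ nf α) {α β : σ →₀ ℕ} (h : RewriteStep l t α β) : nf α = nf β := by
  obtain ⟨d, h1, h2⟩ := church_rosser hconf (hnf α) (.head h (hnf β))
  rw [eq_of_reflTransGen_of_irreducible (hirr α) h1,
    eq_of_reflTransGen_of_irreducible (hirr β) h2]

end Rewriting

/-! ### The linear normal form map -/

section NormalForm

variable {ι σ K : Type*} [Field K] {l t : ι → σ →₀ ℕ}

/-- The `K`-linear map sending each monomial `x ^ α` to `x ^ nf α`. -/
noncomputable def normalFormMap (K : Type*) [Field K] (nf : (σ →₀ ℕ) → σ →₀ ℕ) :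
    MvPolynomial σ K →ₗ[K] MvPolynomial σ K :=
  (basisMonomials σ K).constr K fun α => monomial (nf α) (1 : K)

theorem normalFormMap_monomial (nf : (σ →₀ ℕ) → σ →₀ ℕ) (α : σ →₀ ℕ) (c : K) :
    normalFormMap K nf (monomial α c) = monomial (nf α) c := by
  have h : normalFormMap K nf (monomial α 1) = monomial (nf α) 1 := by
    have := (basisMonomials σ K).constr_basis K (fun α => monomial (nf α) (1 : K)) α
    rwa [coe_basisMonomials] at this
  rw [← mul_one c, ← smul_eq_mul, ← smul_monomial, map_smul, h, smul_monomial]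

theorem normalFormMap_apply (nf : (σ →₀ ℕ) → σ →₀ ℕ) (f : MvPolynomial σ K) :
    normalFormMap K nf f = ∑ α ∈ f.support, monomial (nf α) (coeff α f) := by
  conv_lhs => rw [f.as_sum]
  simp only [map_sum, normalFormMap_monomial]

/-- A monomial multiple of a generator is, up to sign and scalar, the difference of the two ends of
one rewriting step, and these have the same normal form. -/
theorem normalFormMap_eq_zero {S : Set (MvPolynomial σ K)}
    (hS : ∀ f ∈ S, ∃ i, f = monomial (l i) 1 - monomial (t i) 1 ∨
      f = monomial (t i) 1 - monomial (l i) 1)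
    {nf : (σ →₀ ℕ) → σ →₀ ℕ} (hnf : ∀ α β, RewriteStep l t α β → nf α = nf β)
    {f : MvPolynomial σ K} (hf : f ∈ Ideal.span S) : normalFormMap K nf f = 0 := by
  have hmon (q : σ →₀ ℕ) (c : K) (i : ι) : normalFormMap K nf
      (monomial q c * (monomial (l i) 1 - monomial (t i) 1)) = 0 := by
    rw [mul_sub, monomial_mul, monomial_mul, map_sub, normalFormMap_monomial,
      normalFormMap_monomial, hnf _ _ ⟨i, q, rfl, rfl⟩, sub_self]
  have hgen (p : MvPolynomial σ K) (i : ι) : normalFormMap K nf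
      (p * (monomial (l i) 1 - monomial (t i) 1)) = 0 := by
    induction p using MvPolynomial.induction_on' with
    | monomial q c => exact hmon q c i
    | add p p' hp hp' => rw [add_mul, map_add, hp, hp', add_zero]
  -- The map is only `K`-linear, so the induction needs the vanishing of all multiples `p * f`.
  refine (?_ : ∀ f ∈ Ideal.span S, ∀ p, normalFormMap K nf (p * f) = 0) f hf 1 |> fun h => by
    rwa [one_mul] at h
  intro f hf
  induction hf using Submodule.span_induction with
  | mem f hf =>
    intro p
    obtain ⟨i, rfl | rfl⟩ := hS f hf
    · exact hgen p i
    · rw [← neg_sub, mul_neg, map_neg, hgen, neg_zero]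
  | zero => simp
  | add f g _ _ hf hg => intro p; rw [mul_add, map_add, hf, hg, add_zero]
  | smul a f _ hf => intro p; rw [smul_eq_mul, ← mul_assoc]; exact hf _

end NormalForm

/-! ### Leading exponents -/

variable {d : ℕ} {K : Type*} [Field K]

theorem exists_isLeadingExponent {f : MvPolynomial (Fin d) K} (hf : f ≠ 0) :
    ∃ α, IsLeadingExponent f α := by
  -- The leading monomial has the smallest key: low degree and small early exponents count as large.
  let key : (Fin d →₀ ℕ) → ℕ ×ₗ Lex (Fin d → ℕ) := fun α => toLex (α.degree, toLex ⇑α)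
  obtain ⟨α, hα, hmin⟩ := Finset.exists_min_image f.support key (support_nonempty.mpr hf)
  refine ⟨α, hα, fun β hβ hne => ?_⟩
  have hk : key α < key β := lt_of_le_of_ne (hmin β hβ) fun h => hne <| by
    have := congrArg (fun x => ofLex (ofLex x).2) h
    exact DFunLike.coe_injective this.symm
  rcases Prod.Lex.toLex_lt_toLex.mp hk with h | ⟨h, i, hi, hi'⟩
  · exact .inl h
  · exact .inr ⟨h, i, hi, hi'⟩

section Binomial

variable {ι : Type*} {l t : ι → Fin (d + 1) →₀ ℕ} {nf : (Fin (d + 1) →₀ ℕ) → Fin (d + 1) →₀ ℕ}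

/-- Degree and the exponent of `x_1` are the first two criteria of the full ordering, and they
already decide between the two sides of every rule. -/
theorem not_negDegRevLexGT_of_degreeThenExponentLT {α β : Fin (d + 1) →₀ ℕ}
    (h : DegreeThenExponentLT 0 α β) : ¬ NegDegRevLexGT β α := by
  rintro (h' | ⟨h', i, hi, hi'⟩)
  · simp only [DegreeThenExponentLT] at h
    omega
  · rcases h with h | ⟨-, h⟩
    · omega
    · rcases eq_or_ne i 0 with rfl | hne
      · omega
      · have := hi 0 (Fin.pos_of_ne_zero hne)
        omega

theorem isLeadingExponent_binomial {α β : Fin (d + 1) →₀ ℕ} (h : DegreeThenExponentLT 0 α β) :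
    IsLeadingExponent (monomial α (1 : K) - monomial β 1) α := by
  classical
  have hne : β ≠ α := by
    rintro rfl
    simp [DegreeThenExponentLT] at h
  refine ⟨by simp [coeff_monomial, hne], fun γ hγ hγα => ?_⟩
  have : γ = β := by
    by_contra hγβ
    simp [coeff_monomial, Ne.symm hγβ, Ne.symm hγα] at hγ
  subst this
  rcases h with h | ⟨h, h'⟩
  · exact .inl h
  · exact .inr ⟨h, 0, fun j hj => absurd hj (Fin.not_lt_zero j), h'⟩

theorem IsLeadingExponent.neg {f : MvPolynomial (Fin d) K} {α : Fin d →₀ ℕ}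
    (h : IsLeadingExponent f α) : IsLeadingExponent (-f) α := by
  simpa [IsLeadingExponent] using h

/-- The leading exponent of a polynomial with vanishing normal form is reducible. -/
theorem exists_le_of_isLeadingExponent (hlt : ∀ i, DegreeThenExponentLT 0 (l i) (t i))
    (hnf : ∀ α, Relation.ReflTransGen (RewriteStep l t) α (nf α))
    {f : MvPolynomial (Fin (d + 1)) K} (hf : normalFormMap K nf f = 0) {α : Fin (d + 1) →₀ ℕ}
    (hα : IsLeadingExponent f α) : ∃ i, l i ≤ α := by
  classical
  by_contra! hirr
  have hnfα : nf α = α := (eq_of_reflTransGen_of_irreducible hirr (hnf α)).symm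
  have hc := congrArg (coeff α) hf
  rw [normalFormMap_apply, coeff_sum, coeff_zero, Finset.sum_eq_single_of_mem α hα.1] at hc
  · rw [hnfα, coeff_monomial, if_pos rfl] at hc
    exact mem_support_iff.mp hα.1 hc
  -- No other monomial of `f` can reduce to `x ^ α`: reduction only moves down in the ordering,
  -- while `x ^ α` is the largest monomial of `f`.
  · intro β hβ hne
    rw [coeff_monomial, if_neg]
    intro h
    have := hnf β
    rw [h] at this
    rcases eq_or_degreeThenExponentLT_of_reflTransGen hlt this with h | h
    · exact hne h
    · exact not_negDegRevLexGT_of_degreeThenExponentLT h (hα.2 β hβ hne)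

end Binomial

/-! ### Generators of the tangent cone ideal -/

theorem homogeneousComponent_monomial {σ R : Type*} [CommSemiring R] (k : ℕ) (α : σ →₀ ℕ) (c : R) :
    homogeneousComponent k (monomial α c) = if k = α.degree then monomial α c else 0 :=
  homogeneousComponent_of_mem (isHomogeneous_monomial c rfl)

section TangentCone

variable {ι σ : Type*} {l t : ι → σ →₀ ℕ}

/-- The difference telescopes over the rewriting path. Degrees never fall, so in degree `k` each
step contributes either nothing or a monomial times the initial form of a rule. -/
theorem homogeneousComponent_binomial_mem {T : Ideal (MvPolynomial σ K)}
    (hdeg : ∀ i, (l i).degree ≤ (t i).degree)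
    (hT : ∀ i, homogeneousComponent (l i).degree
      (monomial (l i) (1 : K) - monomial (t i) 1) ∈ T)
    {α β : σ →₀ ℕ} (h : Relation.ReflTransGen (RewriteStep l t) α β) {k : ℕ} (hk : k ≤ α.degree)
    (c : K) : homogeneousComponent k (monomial α c - monomial β c) ∈ T := by
  suffices k ≤ β.degree ∧ homogeneousComponent k (monomial α c - monomial β c) ∈ T from this.2
  induction h with
  | refl => simpa using hk
  | tail _ h ih =>
    obtain ⟨i, q, rfl, rfl⟩ := h
    obtain ⟨ih1, ih2⟩ := ih
    have hd := hdeg i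
    rw [map_add] at ih1
    refine ⟨by rw [map_add]; omega, ?_⟩
    rw [← sub_add_sub_cancel _ (monomial (q + l i) c), map_add]
    refine T.add_mem ih2 ?_
    have key : homogeneousComponent k (monomial (q + l i) c - monomial (q + t i) c) =
        if k = q.degree + (l i).degree then monomial q c * homogeneousComponent (l i).degree
          (monomial (l i) (1 : K) - monomial (t i) 1) else 0 := by
      simp only [map_sub, homogeneousComponent_monomial, map_add]
      split_ifs with h1 h2 h3 h3 <;> first | omega | simp [mul_sub, monomial_mul]
    rw [key]
    split_ifs
    · exact T.mul_mem_left _ (hT i)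
    · exact T.zero_mem

theorem leastDegree_le {f : MvPolynomial (Fin d) K} {α : Fin d →₀ ℕ} (hα : α ∈ f.support) :
    leastDegree f ≤ α.degree :=
  Nat.sInf_le ⟨α, hα, rfl⟩

/-- Since the normal form of `f` vanishes, subtracting it writes `f` as a sum of binomials `c (x ^ α
- x ^ nf α)`, all with `α` of degree at least the least degree of `f`. -/
theorem leastForm_mem_of_normalFormMap_eq_zero {l t : ι → Fin d →₀ ℕ}
    {nf : (Fin d →₀ ℕ) → Fin d →₀ ℕ} {T : Ideal (MvPolynomial (Fin d) K)}
    (hdeg : ∀ i, (l i).degree ≤ (t i).degree)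
    (hT : ∀ i, homogeneousComponent (l i).degree
      (monomial (l i) (1 : K) - monomial (t i) 1) ∈ T)
    (hnf : ∀ α, Relation.ReflTransGen (RewriteStep l t) α (nf α))
    {f : MvPolynomial (Fin d) K} (hf : normalFormMap K nf f = 0) : leastForm f ∈ T := by
  have hsum : f = ∑ α ∈ f.support, (monomial α (coeff α f) - monomial (nf α) (coeff α f)) := by
    rw [Finset.sum_sub_distrib, ← normalFormMap_apply nf, hf, sub_zero]
    exact f.as_sum
  have : leastForm f = ∑ α ∈ f.support, homogeneousComponent (leastDegree f)
      (monomial α (coeff α f) - monomial (nf α) (coeff α f)) := by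
    rw [← map_sum, ← hsum, leastForm]
  rw [this]
  exact T.sum_mem fun α hα =>
    homogeneousComponent_binomial_mem hdeg hT (hnf α) (leastDegree_le hα) _

theorem leastForm_binomial {α β : Fin d →₀ ℕ} (hne : α ≠ β) (h : α.degree ≤ β.degree) :
    leastForm (monomial α (1 : K) - monomial β 1) =
      homogeneousComponent α.degree (monomial α (1 : K) - monomial β 1) := by
  classical
  suffices leastDegree (monomial α (1 : K) - monomial β 1) = α.degree by rw [leastForm, this]
  refine le_antisymm (leastDegree_le (by simp [coeff_monomial, hne.symm])) ?_
  refine le_csInf ⟨_, α, by simp [coeff_monomial, hne.symm], rfl⟩ ?_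
  rintro _ ⟨γ, hγ, rfl⟩
  by_cases h1 : γ = α
  · rw [h1]
  · by_cases h2 : γ = β
    · rwa [h2]
    · simp [coeff_monomial, Ne.symm h1, Ne.symm h2] at hγ

theorem tangentConeIdeal_eq {l t : ι → Fin d →₀ ℕ}
    {nf : (Fin d →₀ ℕ) → Fin d →₀ ℕ} {I : Ideal (MvPolynomial (Fin d) K)}
    (hne : ∀ i, l i ≠ t i) (hdeg : ∀ i, (l i).degree ≤ (t i).degree)
    (hnf : ∀ α, Relation.ReflTransGen (RewriteStep l t) α (nf α))
    (hmem : ∀ i, monomial (l i) (1 : K) - monomial (t i) 1 ∈ I)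
    (hI : ∀ f ∈ I, normalFormMap K nf f = 0) :
    tangentConeIdeal I = Ideal.span (Set.range fun i =>
      homogeneousComponent (l i).degree (monomial (l i) (1 : K) - monomial (t i) 1)) := by
  refine le_antisymm (Ideal.span_le.mpr ?_) (Ideal.span_le.mpr ?_)
  · rintro _ ⟨f, hf, rfl⟩
    refine SetLike.mem_coe.mpr
      (leastForm_mem_of_normalFormMap_eq_zero hdeg (fun i => ?_) hnf (hI f hf))
    exact Ideal.subset_span ⟨i, rfl⟩
  · rintro _ ⟨i, rfl⟩
    dsimp only
    rw [← leastForm_binomial (hne i) (hdeg i)]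
    rw [tangentConeIdeal]
    exact Ideal.subset_span (Set.mem_image_of_mem _ (hmem i))

end TangentCone

/-! ### Minimal generating sets via separating coefficients -/

section MinimalGeneration

variable {ι σ K : Type*} [Field K]

/-- No proper divisor of `x ^ e` occurs in `g`, so only the constant term of `p` can contribute. -/
theorem coeff_mul_eq_of_mem_support {e : σ →₀ ℕ} {g : MvPolynomial σ K}
    (hg : ∀ γ ∈ g.support, γ ≤ e → γ = e) (p : MvPolynomial σ K) :
    coeff e (p * g) = constantCoeff p * coeff e g := by
  classical
  rw [coeff_mul, Finset.sum_eq_single (0, e)]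
  · rfl
  · rintro ⟨q, γ⟩ hx hne
    replace hx := Finset.HasAntidiagonal.mem_antidiagonal.mp hx
    dsimp only at hx ⊢
    by_cases hγ : γ ∈ g.support
    · obtain rfl := hg γ hγ (hx ▸ le_add_self)
      exact absurd (by rw [add_eq_right.mp hx]) hne
    · rw [notMem_support_iff.mp hγ, mul_zero]
  · simp

theorem coeff_mul_eq_of_mem_span {e : σ →₀ ℕ} {S : Set (MvPolynomial σ K)}
    (hS : ∀ g ∈ S, ∀ γ ∈ g.support, γ ≤ e → γ = e) {f : MvPolynomial σ K}
    (hf : f ∈ Ideal.span S) (p : MvPolynomial σ K) :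
    coeff e (p * f) = constantCoeff p * coeff e f := by
  induction hf using Submodule.span_induction generalizing p with
  | mem g hg => exact coeff_mul_eq_of_mem_support (hS g hg) p
  | zero => simp
  | add f g _ _ hf hg => rw [mul_add, coeff_add, hf, hg, coeff_add, mul_add]
  | smul a f _ hf => rw [smul_eq_mul, ← mul_assoc, hf, hf, map_mul, mul_assoc]

theorem coeff_eq_zero_of_mem_span {e : σ →₀ ℕ} {S : Set (MvPolynomial σ K)}
    (hS : ∀ g ∈ S, ∀ γ ∈ g.support, γ ≤ e → γ = e) (hc : ∀ g ∈ S, coeff e g = 0)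
    {f : MvPolynomial σ K} (hf : f ∈ Ideal.span S) : coeff e f = 0 := by
  induction hf using Submodule.span_induction with
  | mem g hg => exact hc g hg
  | zero => simp
  | add f g _ _ hf hg => rw [coeff_add, hf, hg, add_zero]
  | smul a f hf' hf => rw [smul_eq_mul, coeff_mul_eq_of_mem_span hS hf', hf, mul_zero]

/-- Generators that are separated by coefficients vanishing on the product of the maximal ideal of
the origin with the ideal form a minimal generating set. -/
theorem isMinimallyGeneratedBy_span_range [DecidableEq ι] {g : ι → MvPolynomial σ K}
    {e : ι → σ →₀ ℕ} (hsupp : ∀ i j, ∀ γ ∈ (g j).support, γ ≤ e i → γ = e i)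
    (hcoeff : ∀ i j, coeff (e i) (g j) = if i = j then 1 else 0) :
    IsMinimallyGeneratedBy (Ideal.span (Set.range g)) (Set.range g) := by
  refine ⟨rfl, ?_⟩
  rintro _ ⟨i, rfl⟩ h
  have hi : g i ∈ Ideal.span (Set.range g \ {g i}) := h ▸ Ideal.subset_span ⟨i, rfl⟩
  have := coeff_eq_zero_of_mem_span (e := e i) ?_ ?_ hi
  · simp [hcoeff] at this
  · rintro _ ⟨⟨j, rfl⟩, -⟩
    exact hsupp i j
  · rintro _ ⟨⟨j, rfl⟩, hj⟩
    rw [hcoeff, if_neg]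
    rintro rfl
    exact hj rfl

/-- Nakayama by hand: on the ideal, the coefficients at the `e i` form a map to `K ^ ι` under which
multiplication by `p` becomes the scalar `p(0)`. It sends the `g j` to the standard basis, so the
image of any generating set spans `K ^ ι`. -/
theorem spanFinrank_span_range [Fintype ι] [DecidableEq ι] {g : ι → MvPolynomial σ K}
    {e : ι → σ →₀ ℕ} (hsupp : ∀ i j, ∀ γ ∈ (g j).support, γ ≤ e i → γ = e i)
    (hcoeff : ∀ i j, coeff (e i) (g j) = if i = j then 1 else 0) :
    (Ideal.span (Set.range g)).spanFinrank = Fintype.card ι := by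
  classical
  refine le_antisymm ?_ ?_
  · refine (Submodule.spanFinrank_span_le_ncard_of_finite (Set.finite_range g)).trans ?_
    rw [← Set.image_univ]
    refine (Set.ncard_image_le Set.finite_univ).trans ?_
    rw [Set.ncard_univ, Nat.card_eq_fintype_card]
  · obtain ⟨s, hcard, hspan⟩ := Submodule.FG.exists_span_finset_card_eq_spanFinrank
      (p := Ideal.span (Set.range g)) (Submodule.fg_span (Set.finite_range g))
    rw [← hcard]
    let φ : MvPolynomial σ K →ₗ[K] ι → K := LinearMap.pi fun i => lcoeff K (e i)
    have hφ (f : MvPolynomial σ K) (i : ι) : φ f i = coeff (e i) f := rfl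
    have hmul (p : MvPolynomial σ K) {f : MvPolynomial σ K} (hf : f ∈ Ideal.span (Set.range g)) :
        φ (p * f) = constantCoeff p • φ f := by
      ext i
      rw [Pi.smul_apply, hφ, hφ, smul_eq_mul]
      exact coeff_mul_eq_of_mem_span (by rintro _ ⟨j, rfl⟩; exact hsupp i j) hf p
    have hmem {f : MvPolynomial σ K} (hf : f ∈ Ideal.span (s : Set (MvPolynomial σ K))) :
        φ f ∈ Submodule.span K (s.image φ : Set (ι → K)) := by
      induction hf using Submodule.span_induction with
      | mem g hg => exact Submodule.subset_span (by simpa using ⟨g, hg, rfl⟩)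
      | zero => simp
      | add f g _ _ hf hg => rw [map_add]; exact Submodule.add_mem _ hf hg
      | smul a f hf' hf =>
        rw [smul_eq_mul, hmul a (hspan ▸ hf')]
        exact Submodule.smul_mem _ _ hf
    have htop : Submodule.span K (s.image φ : Set (ι → K)) = ⊤ := by
      rw [eq_top_iff, ← (Pi.basisFun K ι).span_eq, Submodule.span_le]
      rintro _ ⟨j, rfl⟩
      have : (Pi.basisFun K ι) j = φ (g j) := by
        ext i
        rw [hφ, hcoeff, Pi.basisFun_apply, Pi.single_apply]
      rw [this]
      refine hmem ?_
      have : g j ∈ Ideal.span (Set.range g) := Ideal.subset_span ⟨j, rfl⟩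
      rwa [← hspan] at this
    have h1 := finrank_span_finset_le_card (R := K) (s.image φ)
    rw [Set.finrank, htop, finrank_top, Module.finrank_fintype_fun_eq_card] at h1
    exact h1.trans Finset.card_image_le

end MinimalGeneration

/-! ### Weights and binomials of the toric ideal -/

section Weight

variable {d : ℕ} {K : Type*} [Field K]

/-- The exponent of `t` in the image of `x ^ α` under `x_i ↦ t ^ n i`. -/
noncomputable def curveWeight (n : Fin d → ℕ) : (Fin d →₀ ℕ) →+ ℕ where
  toFun α := ∑ i, α i * n i
  map_zero' := by simp
  map_add' α β := by simp [add_mul, Finset.sum_add_distrib]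

theorem curveWeight_apply (n : Fin d → ℕ) (α : Fin d →₀ ℕ) :
    curveWeight n α = ∑ i, α i * n i := rfl

theorem degree_le_curveWeight {n : Fin d → ℕ} (hn : ∀ i, 0 < n i) (α : Fin d →₀ ℕ) :
    α.degree ≤ curveWeight n α := by
  rw [Finsupp.degree_eq_sum, curveWeight_apply]
  exact Finset.sum_le_sum fun i _ => Nat.le_mul_of_pos_right _ (hn i)

theorem binomial_mem_toricIdeal_iff {n : Fin d → ℕ} {α β : Fin d →₀ ℕ} :
    monomial α (1 : K) - monomial β 1 ∈ toricIdeal K n ↔ curveWeight n α = curveWeight n β := by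
  have h (γ : Fin d →₀ ℕ) : aeval (fun i => (Polynomial.X : Polynomial K) ^ n i)
      (monomial γ (1 : K)) = Polynomial.X ^ curveWeight n γ := by
    rw [aeval_monomial, map_one, one_mul, Finsupp.prod_fintype _ _ (by simp), curveWeight_apply,
      ← Finset.prod_pow_eq_pow_sum]
    exact Finset.prod_congr rfl fun i _ => by rw [← pow_mul, mul_comm]
  rw [toricIdeal, RingHom.mem_ker, map_sub, h, h, sub_eq_zero]
  exact ⟨fun h => by simpa using congrArg Polynomial.natDegree h, fun h => by rw [h]⟩

/-- If every generator restricts to a multiple of `X ^ a` on the `v`-axis, then a pure power of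
`x_v` that is congruent to a nontrivial monomial in the other variables has exponent at least
`a`. -/
theorem le_of_curveWeight_single_eq {n : Fin d → ℕ} {S : Set (MvPolynomial (Fin d) K)}
    (hS : toricIdeal K n = Ideal.span S) (v : Fin d) {a : ℕ}
    (haxis : ∀ f ∈ S, (Polynomial.X : Polynomial K) ^ a ∣
      aeval (Pi.single v (Polynomial.X : Polynomial K)) f)
    {k : ℕ} {β : Fin d →₀ ℕ} (hβ : ∃ j, j ≠ v ∧ β j ≠ 0)
    (h : curveWeight n (Finsupp.single v k) = curveWeight n β) : a ≤ k := by
  have hmem : monomial (Finsupp.single v k) (1 : K) - monomial β 1 ∈ Ideal.span S :=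
    hS ▸ binomial_mem_toricIdeal_iff.mpr h
  have hle : Ideal.span S ≤ (Ideal.span {(Polynomial.X : Polynomial K) ^ a}).comap
      (aeval (Pi.single v (Polynomial.X : Polynomial K))) :=
    Ideal.span_le.mpr fun f hf => Ideal.mem_span_singleton.mpr (haxis f hf)
  have h1 := Ideal.mem_span_singleton.mp (hle hmem)
  obtain ⟨j, hj, hβj⟩ := hβ
  have h2 : aeval (Pi.single v (Polynomial.X : Polynomial K)) (monomial β (1 : K)) = 0 := by
    rw [aeval_monomial, Finsupp.prod_fintype _ _ (by simp),
      Finset.prod_eq_zero (Finset.mem_univ j), mul_zero]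
    rw [Pi.single_eq_of_ne hj, zero_pow hβj]
  rw [map_sub, h2, sub_zero, aeval_monomial, Finsupp.prod_single_index (by simp), map_one, one_mul,
    Pi.single_eq_same] at h1
  exact (pow_dvd_pow_iff Polynomial.X_ne_zero Polynomial.not_isUnit_X).mp h1

end Weight

/-! ### Exponents in four variables -/

section FourVariables

/-- The exponent of `x_1 ^ p * x_2 ^ q * x_3 ^ r * x_4 ^ s`. -/
noncomputable def exponentOf (p q r s : ℕ) : Fin 4 →₀ ℕ :=
  Finsupp.equivFunOnFinite.symm ![p, q, r, s]

@[simp] theorem exponentOf_zero (p q r s : ℕ) : exponentOf p q r s 0 = p := rfl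
@[simp] theorem exponentOf_one (p q r s : ℕ) : exponentOf p q r s 1 = q := rfl
@[simp] theorem exponentOf_two (p q r s : ℕ) : exponentOf p q r s 2 = r := rfl
@[simp] theorem exponentOf_three (p q r s : ℕ) : exponentOf p q r s 3 = s := rfl

theorem monomial_exponentOf {R : Type*} [CommSemiring R] (p q r s : ℕ) :
    monomial (exponentOf p q r s) (1 : R) = X 0 ^ p * X 1 ^ q * X 2 ^ r * X 3 ^ s := by
  rw [monomial_eq, C_1, one_mul, Finsupp.prod_fintype _ _ (by simp), Fin.prod_univ_four]
  simp

@[simp] theorem degree_exponentOf (p q r s : ℕ) : (exponentOf p q r s).degree = p + q + r + s := by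
  simp [Finsupp.degree_eq_sum, Fin.sum_univ_four]

theorem curveWeight_exponentOf (n : Fin 4 → ℕ) (p q r s : ℕ) :
    curveWeight n (exponentOf p q r s) = p * n 0 + q * n 1 + r * n 2 + s * n 3 := by
  simp [curveWeight_apply, Fin.sum_univ_four]

theorem fourVar_le_iff {α β : Fin 4 →₀ ℕ} :
    α ≤ β ↔ α 0 ≤ β 0 ∧ α 1 ≤ β 1 ∧ α 2 ≤ β 2 ∧ α 3 ≤ β 3 := by
  simp [Finsupp.le_def, Fin.forall_fin_succ]

theorem fourVar_ext_iff {α β : Fin 4 →₀ ℕ} :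
    α = β ↔ α 0 = β 0 ∧ α 1 = β 1 ∧ α 2 = β 2 ∧ α 3 = β 3 := by
  simp [Finsupp.ext_iff, Fin.forall_fin_succ]

end FourVariables

/-! ### The rewriting system of the curve -/

/-- The free exponents of a non-complete-intersection Gorenstein monomial curve. -/
structure CurveExponents where
  a12 : ℕ
  a14 : ℕ
  a23 : ℕ
  a24 : ℕ
  a31 : ℕ
  a32 : ℕ
  a41 : ℕ
  a43 : ℕ

namespace CurveExponents

/-- The exponents of the leading monomials of the standard basis. -/
noncomputable def lead (p : CurveExponents) : Fin 7 → Fin 4 →₀ ℕ :=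
  ![exponentOf 0 p.a12 0 p.a14,
    exponentOf 0 0 p.a23 p.a24,
    exponentOf 0 0 (p.a23 + p.a43) 0,
    exponentOf 0 0 0 (p.a14 + p.a24),
    exponentOf p.a31 0 0 p.a24,
    exponentOf 0 (p.a12 + p.a32 + p.a12) 0 0,
    exponentOf 0 (2 * p.a12) p.a43 0]

/-- The exponents of the trailing monomials of the standard basis. -/
noncomputable def trail (p : CurveExponents) : Fin 7 → Fin 4 →₀ ℕ :=
  ![exponentOf (p.a31 + p.a41) 0 0 0,
    exponentOf 0 (p.a12 + p.a32) 0 0,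
    exponentOf p.a31 p.a32 0 0,
    exponentOf p.a41 0 p.a43 0,
    exponentOf 0 p.a12 p.a43 0,
    exponentOf (p.a31 + p.a41) 0 p.a23 (p.a24 - p.a14),
    exponentOf (p.a31 + p.a41 + p.a31) 0 0 (p.a24 - p.a14)]

variable (p : CurveExponents)

/-- For `i < j`, the rules (if any) that join the critical pair of the rules `i` and `j`. -/
def joiningRules : Fin 7 → Fin 7 → Option (Fin 7) × Option (Fin 7) :=
  ![![default, (none, some 5), (some 2, some 0), (some 4, none), (none, some 6), (none, some 1),
      (none, some 4)],
    ![default, default, (none, some 4), (some 0, some 2), (none, some 2), (some 5, some 1),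
      (some 5, some 4)],
    ![default, default, default, (some 3, some 2), (some 4, some 2), (some 5, some 2),
      (some 5, none)],
    ![default, default, default, default, (none, some 0), (some 5, some 3), (some 6, some 3)],
    ![default, default, default, default, default, (some 5, some 4), (some 6, some 4)],
    ![default, default, default, default, default, default, (some 2, none)],
    default]

set_option maxHeartbeats 1000000 in
-- the 21 critical pairs
theorem joiningRules_spec (h : p.a14 ≤ p.a24) : ∀ i j, i < j → ∀ q q' : Fin 4 →₀ ℕ,
    q + p.lead i = q' + p.lead j →
      (joiningRules i j).1.elim 0 p.lead ≤ q + p.trail i ∧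
      (joiningRules i j).2.elim 0 p.lead ≤ q' + p.trail j ∧
      q + p.trail i - (joiningRules i j).1.elim 0 p.lead + (joiningRules i j).1.elim 0 p.trail =
        q' + p.trail j - (joiningRules i j).2.elim 0 p.lead +
          (joiningRules i j).2.elim 0 p.trail := by
  intro i j hij q q' hq
  rw [fourVar_ext_iff] at hq
  rw [fourVar_le_iff, fourVar_le_iff, fourVar_ext_iff]
  simp only [Finsupp.add_apply, Finsupp.tsub_apply] at hq ⊢
  generalize q 0 = x0, q 1 = x1, q 2 = x2, q 3 = x3, q' 0 = y0, q' 1 = y1, q' 2 = y2,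
    q' 3 = y3 at hq ⊢
  fin_cases i <;> fin_cases j <;> first
    | exact absurd hij (by decide)
    | (simp [joiningRules, lead, trail] at hq ⊢; omega)

theorem reflGen_rewriteStep {o : Option (Fin 7)} {α : Fin 4 →₀ ℕ} (h : o.elim 0 p.lead ≤ α) :
    Relation.ReflGen (RewriteStep p.lead p.trail) α (α - o.elim 0 p.lead + o.elim 0 p.trail) := by
  cases o with
  | none => simpa using Relation.ReflGen.refl
  | some i => exact .single ⟨i, _, (tsub_add_cancel_of_le h).symm, rfl⟩

theorem joinable_of_lt (h : p.a14 ≤ p.a24) {i j : Fin 7} (hij : i < j) {q q' : Fin 4 →₀ ℕ}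
    (hq : q + p.lead i = q' + p.lead j) :
    ∃ γ, Relation.ReflGen (RewriteStep p.lead p.trail) (q + p.trail i) γ ∧
      Relation.ReflGen (RewriteStep p.lead p.trail) (q' + p.trail j) γ := by
  obtain ⟨h1, h2, h3⟩ := p.joiningRules_spec h i j hij q q' hq
  exact ⟨_, p.reflGen_rewriteStep h1, h3 ▸ p.reflGen_rewriteStep h2⟩

/-- Two different rules applied to the same exponent are joined by at most one further step on each
side. This strong form of local confluence is what Church–Rosser uses. -/
theorem strongly_confluent (h : p.a14 ≤ p.a24) (α β γ : Fin 4 →₀ ℕ)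
    (hβ : RewriteStep p.lead p.trail α β) (hγ : RewriteStep p.lead p.trail α γ) :
    ∃ δ, Relation.ReflGen (RewriteStep p.lead p.trail) β δ ∧
      Relation.ReflTransGen (RewriteStep p.lead p.trail) γ δ := by
  obtain ⟨i, q, rfl, rfl⟩ := hβ
  obtain ⟨j, q', hq, rfl⟩ := hγ
  rcases lt_trichotomy i j with hij | rfl | hij
  · obtain ⟨δ, h1, h2⟩ := p.joinable_of_lt h hij hq
    exact ⟨δ, h1, h2.to_reflTransGen⟩
  · rw [add_right_cancel hq]
    exact ⟨_, .refl, .refl⟩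
  · obtain ⟨δ, h1, h2⟩ := p.joinable_of_lt h hij hq.symm
    exact ⟨δ, h2, h1.to_reflTransGen⟩

/-- The degree conditions satisfied by the exponents of the curve. -/
structure IsAdmissible (p : CurveExponents) : Prop where
  pos : 0 < p.a12 ∧ 0 < p.a14 ∧ 0 < p.a23 ∧ 0 < p.a24 ∧ 0 < p.a31 ∧ 0 < p.a32 ∧ 0 < p.a41 ∧
    0 < p.a43
  le : p.a14 ≤ p.a24
  degree_one : p.a12 + p.a14 < p.a31 + p.a41
  degree_two : p.a23 + p.a24 < p.a12 + p.a32
  degree_three : p.a23 + p.a43 < p.a31 + p.a32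
  degree_four : p.a14 + p.a24 < p.a41 + p.a43
  degree_five : p.a31 + p.a24 < p.a12 + p.a43
  degree_six : p.a12 + p.a32 + p.a12 ≤ p.a31 + p.a41 + p.a23 + (p.a24 - p.a14)

variable {p}

/-- Only rule 5 can preserve the degree, and then `x_1` occurs in its trailing monomial but not in
its leading one. The degree inequality for rule 6 is the sum of `degree_three` and `degree_six`. -/
theorem IsAdmissible.degreeThenExponentLT (hp : p.IsAdmissible) (i : Fin 7) :
    DegreeThenExponentLT 0 (p.lead i) (p.trail i) := by
  obtain ⟨hpos, h0, h1, h2, h3, h4, h5, h6⟩ := hp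
  fin_cases i <;> simp [DegreeThenExponentLT, lead, trail] <;> omega

theorem IsAdmissible.degree_le (hp : p.IsAdmissible) (i : Fin 7) :
    (p.lead i).degree ≤ (p.trail i).degree := by
  rcases hp.degreeThenExponentLT i with h | h
  · exact h.le
  · exact h.1.le

theorem IsAdmissible.lead_ne_trail (hp : p.IsAdmissible) (i : Fin 7) : p.lead i ≠ p.trail i := by
  intro h
  have := hp.degreeThenExponentLT i
  rw [h] at this
  simp [DegreeThenExponentLT] at this

set_option maxHeartbeats 1000000 in
-- 49 pairs of monomials
theorem IsAdmissible.eq_of_lead_le (hp : p.IsAdmissible) (i j : Fin 7)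
    (h : p.lead j ≤ p.lead i) : j = i := by
  obtain ⟨hpos, h0, h1, h2, h3, h4, h5, h6⟩ := hp
  rw [fourVar_le_iff] at h
  fin_cases i <;> fin_cases j <;> first
    | rfl
    | (simp [lead] at h; omega)

/-- This monomial involves both `x_1` and `x_3`, and no leading monomial does. It matters when the
initial form of rule 5 is a binomial. -/
theorem IsAdmissible.not_trail_le_lead (hp : p.IsAdmissible) (i : Fin 7) :
    ¬ p.trail 5 ≤ p.lead i := by
  obtain ⟨hpos, h0, h1, h2, h3, h4, h5, h6⟩ := hp
  rw [fourVar_le_iff]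
  fin_cases i <;> simp [lead, trail] <;> omega

end CurveExponents
-- Relations between the exponents of the curve
section Curve

variable {K : Type*} [Field K]

theorem curveWeight_eq_of_mem_toricIdeal {n : Fin 4 → ℕ} {f : MvPolynomial (Fin 4) K}
    (hf : f ∈ toricIdeal K n) {p q r s p' q' r' s' : ℕ}
    (h : f = monomial (exponentOf p q r s) 1 - monomial (exponentOf p' q' r' s') 1) :
    p * n 0 + q * n 1 + r * n 2 + s * n 3 = p' * n 0 + q' * n 1 + r' * n 2 + s' * n 3 := by
  rw [← curveWeight_exponentOf, ← curveWeight_exponentOf]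
  exact binomial_mem_toricIdeal_iff.mp (h ▸ hf)

/-- The relations between the exponents in the generators of a non-complete-intersection
Gorenstein monomial curve, together with the weight equations. -/
theorem exponent_relations
    {n : Fin 4 → ℕ} (hn : ∀ i, 0 < n i)
    {a1 a2 a3 a4 a12 a14 a23 a24 a31 a32 a41 a43 : ℕ}
    (h12 : 0 < a12 ∧ a12 < a2) (h14 : 0 < a14 ∧ a14 < a4)
    (h23 : 0 < a23 ∧ a23 < a3) (h24 : 0 < a24 ∧ a24 < a4)
    (h31 : 0 < a31 ∧ a31 < a1) (h32 : 0 < a32 ∧ a32 < a2)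
    (h41 : 0 < a41 ∧ a41 < a1) (h43 : 0 < a43 ∧ a43 < a3)
    (hI : IsMinimallyGeneratedBy (toricIdeal K n)
      {X 0 ^ a1 - X 1 ^ a12 * X 3 ^ a14,
       X 1 ^ a2 - X 2 ^ a23 * X 3 ^ a24,
       X 2 ^ a3 - X 0 ^ a31 * X 1 ^ a32,
       X 3 ^ a4 - X 0 ^ a41 * X 2 ^ a43,
       X 0 ^ a31 * X 3 ^ a24 - X 1 ^ a12 * X 2 ^ a43}) :
    a1 = a31 + a41 ∧ a2 = a12 + a32 ∧ a3 = a23 + a43 ∧ a4 = a14 + a24 ∧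
      a1 * n 0 = a12 * n 1 + a14 * n 3 ∧ a2 * n 1 = a23 * n 2 + a24 * n 3 ∧
      a3 * n 2 = a31 * n 0 + a32 * n 1 ∧ a4 * n 3 = a41 * n 0 + a43 * n 2 ∧
      a31 * n 0 + a24 * n 3 = a12 * n 1 + a43 * n 2 := by
  have hspan := hI.1.symm
  have hmem := fun f hf => (hI.1 ▸ Ideal.subset_span (α := MvPolynomial (Fin 4) K) hf :
    f ∈ toricIdeal K n)
  simp only [Set.mem_insert_iff, Set.mem_singleton_iff, forall_eq_or_imp, forall_eq] at hmem
  obtain ⟨m1, m2, m3, m4, m5⟩ := hmem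
  have e1 := curveWeight_eq_of_mem_toricIdeal m1 (p := a1) (q := 0) (r := 0) (s := 0) (p' := 0)
    (q' := a12) (r' := 0) (s' := a14) (by simp [monomial_exponentOf])
  have e2 := curveWeight_eq_of_mem_toricIdeal m2 (p := 0) (q := a2) (r := 0) (s := 0) (p' := 0)
    (q' := 0) (r' := a23) (s' := a24) (by simp [monomial_exponentOf])
  have e3 := curveWeight_eq_of_mem_toricIdeal m3 (p := 0) (q := 0) (r := a3) (s := 0) (p' := a31)
    (q' := a32) (r' := 0) (s' := 0) (by simp [monomial_exponentOf])
  have e4 := curveWeight_eq_of_mem_toricIdeal m4 (p := 0) (q := 0) (r := 0) (s := a4) (p' := a41)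
    (q' := 0) (r' := a43) (s' := 0) (by simp [monomial_exponentOf])
  have e5 := curveWeight_eq_of_mem_toricIdeal m5 (p := a31) (q := 0) (r := 0) (s := a24) (p' := 0)
    (q' := a12) (r' := a43) (s' := 0) (by simp [monomial_exponentOf])
  -- On the `x_1`-axis every generator except `f_1` vanishes, and `f_1` becomes `X ^ a1`. The other
  -- three axes behave likewise.
  have min1 (k q r s : ℕ) (hne : q ≠ 0 ∨ r ≠ 0 ∨ s ≠ 0)
      (h : k * n 0 = q * n 1 + r * n 2 + s * n 3) : a1 ≤ k := by
    refine le_of_curveWeight_single_eq (β := exponentOf 0 q r s) hspan 0 ?_ ?_ ?_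
    · simp [h12.1.ne', h32.1.ne', h24.1.ne', h43.1.ne', h23.1.ne', (h12.1.trans h12.2).ne',
        (h23.1.trans h23.2).ne', (h24.1.trans h24.2).ne']
    · simpa [Fin.exists_fin_succ] using hne
    · rw [curveWeight_exponentOf]
      simpa [curveWeight_apply, Fin.sum_univ_four, Finsupp.single_apply] using h
  have min2 (k p r s : ℕ) (hne : p ≠ 0 ∨ r ≠ 0 ∨ s ≠ 0)
      (h : k * n 1 = p * n 0 + r * n 2 + s * n 3) : a2 ≤ k := by
    refine le_of_curveWeight_single_eq (β := exponentOf p 0 r s) hspan 1 ?_ ?_ ?_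
    · simp [h14.1.ne', h31.1.ne', h24.1.ne', h41.1.ne', h43.1.ne', h23.1.ne',
        (h31.1.trans h31.2).ne', (h23.1.trans h23.2).ne', (h24.1.trans h24.2).ne']
    · simpa [Fin.exists_fin_succ] using hne
    · rw [curveWeight_exponentOf]
      simpa [curveWeight_apply, Fin.sum_univ_four, Finsupp.single_apply] using h
  have min3 (k p q s : ℕ) (hne : p ≠ 0 ∨ q ≠ 0 ∨ s ≠ 0)
      (h : k * n 2 = p * n 0 + q * n 1 + s * n 3) : a3 ≤ k := by
    refine le_of_curveWeight_single_eq (β := exponentOf p q 0 s) hspan 2 ?_ ?_ ?_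
    · simp [h12.1.ne', h14.1.ne', h31.1.ne', h24.1.ne', h41.1.ne', h32.1.ne',
        (h31.1.trans h31.2).ne', (h12.1.trans h12.2).ne', (h24.1.trans h24.2).ne']
    · simpa [Fin.exists_fin_succ] using hne
    · rw [curveWeight_exponentOf]
      simpa [curveWeight_apply, Fin.sum_univ_four, Finsupp.single_apply] using h
  have min4 (k p q r : ℕ) (hne : p ≠ 0 ∨ q ≠ 0 ∨ r ≠ 0)
      (h : k * n 3 = p * n 0 + q * n 1 + r * n 2) : a4 ≤ k := by
    refine le_of_curveWeight_single_eq (β := exponentOf p q r 0) hspan 3 ?_ ?_ ?_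
    · simp [h12.1.ne', h31.1.ne', h23.1.ne', h41.1.ne', h32.1.ne', h43.1.ne',
        (h31.1.trans h31.2).ne', (h12.1.trans h12.2).ne', (h23.1.trans h23.2).ne']
    · simpa [Fin.exists_fin_succ] using hne
    · rw [curveWeight_exponentOf]
      simpa [curveWeight_apply, Fin.sum_univ_four, Finsupp.single_apply] using h
  have n0 := hn 0
  have n1 := hn 1
  have n3 := hn 3
  -- The weight equations of `f_1` and `f_5` give `(a14 + a24) n_4 = (a1 - a31) n_1 + a43 n_3`, so
  -- `a4 ≤ a14 + a24`. A positive excess `u` would make `u n_4` a multiple of `n_1` with factor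
  -- below `a1`, contradicting `min1`.
  have key14 : a1 = a31 + a41 ∧ a4 = a14 + a24 := by
    obtain ⟨b, rfl⟩ := Nat.exists_eq_add_of_lt h31.2
    obtain ⟨u, hu⟩ := Nat.exists_eq_add_of_le
      (min4 (a14 + a24) (b + 1) 0 a43 (by simp) (by linarith))
    rcases Nat.eq_zero_or_pos u with rfl | hupos
    · have : (b + 1) * n 0 = a41 * n 0 := by
        have : (a14 + a24) * n 3 = (a4 + 0) * n 3 := by rw [hu]
        linarith
      have := Nat.eq_of_mul_eq_mul_right n0 this
      omega
    · have h1 : (b + 1) * n 0 = a41 * n 0 + u * n 3 := by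
        have : (a14 + a24) * n 3 = (a4 + u) * n 3 := by rw [hu]
        linarith
      have h2 : a41 < b + 1 := by
        have := Nat.mul_pos hupos n3
        exact Nat.lt_of_mul_lt_mul_right (a := n 0) (by omega)
      obtain ⟨v, hv⟩ := Nat.exists_eq_add_of_lt h2
      have := min1 (v + 1) 0 0 u (by simp; omega) (by rw [hv] at h1; linarith)
      omega
  -- The same argument, with `f_3` and `f_5` giving `(a12 + a32) n_2 = (a3 - a43) n_3 + a24 n_4`.
  have key23 : a2 = a12 + a32 ∧ a3 = a23 + a43 := by
    obtain ⟨b, rfl⟩ := Nat.exists_eq_add_of_lt h43.2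
    obtain ⟨u, hu⟩ := Nat.exists_eq_add_of_le
      (min2 (a12 + a32) 0 (b + 1) a24 (by simp) (by linarith))
    rcases Nat.eq_zero_or_pos u with rfl | hupos
    · have : (b + 1) * n 2 = a23 * n 2 := by
        have : (a12 + a32) * n 1 = (a2 + 0) * n 1 := by rw [hu]
        linarith
      have := Nat.eq_of_mul_eq_mul_right (hn 2) this
      omega
    · have h1 : (b + 1) * n 2 = a23 * n 2 + u * n 1 := by
        have : (a12 + a32) * n 1 = (a2 + u) * n 1 := by rw [hu]
        linarith
      have h2 : a23 < b + 1 := by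
        have := Nat.mul_pos hupos n1
        exact Nat.lt_of_mul_lt_mul_right (a := n 2) (by omega)
      obtain ⟨v, hv⟩ := Nat.exists_eq_add_of_lt h2
      have := min3 (v + 1) 0 u 0 (by simp; omega) (by rw [hv] at h1; linarith)
      omega
  refine ⟨key14.1, key23.1, key23.2, key14.2, ?_, ?_, ?_, ?_, ?_⟩ <;> linarith

end Curve

/-! ### Initial forms of the seven rules -/

namespace CurveExponents

variable {p : CurveExponents}

theorem IsAdmissible.degree_lt (hp : p.IsAdmissible) {i : Fin 7} (hi : i ≠ 5) :
    (p.lead i).degree < (p.trail i).degree := by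
  obtain ⟨hpos, h0, h1, h2, h3, h4, h5, h6⟩ := hp
  fin_cases i <;> first
    | exact absurd rfl hi
    | (simp [lead, trail]; omega)

/-- The binomials of the standard basis, with leading coefficient `1`. -/
noncomputable def binomial (p : CurveExponents) (K : Type*) [Field K] (i : Fin 7) :
    MvPolynomial (Fin 4) K :=
  monomial (p.lead i) 1 - monomial (p.trail i) 1

/-- The least forms of the binomials of the standard basis. -/
noncomputable def initialForm (p : CurveExponents) (K : Type*) [Field K] (i : Fin 7) :
    MvPolynomial (Fin 4) K :=
  homogeneousComponent (p.lead i).degree (monomial (p.lead i) 1 - monomial (p.trail i) 1)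

variable (K : Type*) [Field K]

theorem coeff_initialForm (α : Fin 4 →₀ ℕ) (i : Fin 7) :
    coeff α (p.initialForm K i) = if α.degree = (p.lead i).degree then
      (if p.lead i = α then 1 else 0) - (if p.trail i = α then 1 else 0) else 0 := by
  classical
  rw [initialForm, coeff_homogeneousComponent, coeff_sub, coeff_monomial, coeff_monomial]

/-- The support of an initial form is the leading exponent and, for rule 5 alone, possibly the
trailing one. The former form an antichain and the latter divides none of them. -/
theorem IsAdmissible.eq_of_mem_support_initialForm (hp : p.IsAdmissible) (i j : Fin 7)
    (γ : Fin 4 →₀ ℕ) (hγ : γ ∈ (p.initialForm K j).support) (hle : γ ≤ p.lead i) :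
    γ = p.lead i := by
  rw [mem_support_iff, coeff_initialForm] at hγ
  split_ifs at hγ with h1 h2 h3 h3
  · exact absurd (h2.trans h3.symm) (hp.lead_ne_trail j)
  · rw [← h2] at hle ⊢
    rw [hp.eq_of_lead_le i j hle]
  · have hj : j = 5 := by
      by_contra hj
      have := hp.degree_lt hj
      rw [h3] at this
      omega
    subst hj
    exact absurd (h3 ▸ hle) (hp.not_trail_le_lead i)
  · simp at hγ
  · simp at hγ

theorem IsAdmissible.coeff_lead_initialForm (hp : p.IsAdmissible) (i j : Fin 7) :
    coeff (p.lead i) (p.initialForm K j) = if i = j then 1 else 0 := by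
  by_cases h : i = j
  · subst h
    simp [coeff_initialForm, (hp.lead_ne_trail i).symm]
  · have h1 : p.lead j ≠ p.lead i := fun h' => h (hp.eq_of_lead_le i j h'.le).symm
    rw [coeff_initialForm, if_neg h1, if_neg h]
    split_ifs with h2 h3
    · have hj : j = 5 := by
        by_contra hj
        have := hp.degree_lt hj
        rw [h3] at this
        omega
      subst hj
      exact absurd h3.le (hp.not_trail_le_lead i)
    · simp
    · rfl

theorem initialForm_of_lt {i : Fin 7}
    (h : (p.lead i).degree < (p.trail i).degree) :
    p.initialForm K i = monomial (p.lead i) 1 := by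
  rw [initialForm, map_sub, homogeneousComponent_monomial, homogeneousComponent_monomial,
    if_pos rfl, if_neg h.ne, sub_zero]

theorem initialForm_of_eq {i : Fin 7}
    (h : (p.lead i).degree = (p.trail i).degree) :
    p.initialForm K i = monomial (p.lead i) 1 - monomial (p.trail i) 1 := by
  rw [initialForm, map_sub, homogeneousComponent_monomial, homogeneousComponent_monomial,
    if_pos rfl, if_pos h]

end CurveExponents

theorem range_fin_seven {α : Type*} (f : Fin 7 → α) :
    Set.range f = {f 0, f 1, f 2, f 3, f 4, f 5, f 6} := by
  ext x
  simp [Fin.exists_fin_succ, eq_comm]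

/-- At equal weight, lighter variables need a higher degree; `0 < b` makes the inequality strict. -/
theorem add_lt_of_mul_eq {a b c m x y : ℕ} (hb : 0 < b) (hx : m < x) (hy : m < y)
    (h : a * m = b * x + c * y) : b + c < a := by
  refine Nat.lt_of_mul_lt_mul_right (a := m) ?_
  rw [h, add_mul]
  exact add_lt_add_of_lt_of_le (Nat.mul_lt_mul_of_pos_left hx hb) (Nat.mul_le_mul_left c hy.le)

theorem lt_add_of_mul_eq {a b c m x y : ℕ} (hb : 0 < b) (hx : x < m) (hy : y < m)
    (h : a * m = b * x + c * y) : a < b + c := by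
  refine Nat.lt_of_mul_lt_mul_right (a := m) ?_
  rw [h, add_mul]
  exact add_lt_add_of_lt_of_le (Nat.mul_lt_mul_of_pos_left hx hb) (Nat.mul_le_mul_left c hy.le)

/-! ### Matching the rules with the stated polynomials -/

namespace CurveExponents

variable {p : CurveExponents} {K : Type*} [Field K]

theorem binomial_eq : p.binomial K =
    ![X 1 ^ p.a12 * X 3 ^ p.a14 - X 0 ^ (p.a31 + p.a41),
      X 2 ^ p.a23 * X 3 ^ p.a24 - X 1 ^ (p.a12 + p.a32),
      X 2 ^ (p.a23 + p.a43) - X 0 ^ p.a31 * X 1 ^ p.a32,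
      X 3 ^ (p.a14 + p.a24) - X 0 ^ p.a41 * X 2 ^ p.a43,
      X 0 ^ p.a31 * X 3 ^ p.a24 - X 1 ^ p.a12 * X 2 ^ p.a43,
      X 1 ^ (p.a12 + p.a32 + p.a12) - X 0 ^ (p.a31 + p.a41) * X 2 ^ p.a23 * X 3 ^ (p.a24 - p.a14),
      X 1 ^ (2 * p.a12) * X 2 ^ p.a43 -
        X 0 ^ (p.a31 + p.a41 + p.a31) * X 3 ^ (p.a24 - p.a14)] := by
  funext i
  fin_cases i <;> simp [binomial, lead, trail, monomial_exponentOf]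

theorem initialForm_eq_monomial (hp : p.IsAdmissible) {i : Fin 7} (hi : i ≠ 5) :
    p.initialForm K i = monomial (p.lead i) 1 :=
  initialForm_of_lt K (hp.degree_lt hi)

theorem range_initialForm (hp : p.IsAdmissible) :
    Set.range (p.initialForm K) =
      {X 1 ^ p.a12 * X 3 ^ p.a14, X 2 ^ p.a23 * X 3 ^ p.a24, X 2 ^ (p.a23 + p.a43),
        X 3 ^ (p.a14 + p.a24), X 0 ^ p.a31 * X 3 ^ p.a24, p.initialForm K 5,
        X 1 ^ (2 * p.a12) * X 2 ^ p.a43} := by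
  rw [range_fin_seven, initialForm_eq_monomial hp (by decide : (0 : Fin 7) ≠ 5),
    initialForm_eq_monomial hp (by decide : (1 : Fin 7) ≠ 5),
    initialForm_eq_monomial hp (by decide : (2 : Fin 7) ≠ 5),
    initialForm_eq_monomial hp (by decide : (3 : Fin 7) ≠ 5),
    initialForm_eq_monomial hp (by decide : (4 : Fin 7) ≠ 5),
    initialForm_eq_monomial hp (by decide : (6 : Fin 7) ≠ 5)]
  simp [lead, monomial_exponentOf]

theorem initialForm_five_of_lt
    (h : p.a12 + p.a32 + p.a12 < p.a31 + p.a41 + p.a23 + (p.a24 - p.a14)) :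
    p.initialForm K 5 = X 1 ^ (p.a12 + p.a32 + p.a12) := by
  rw [initialForm_of_lt K (by simpa [lead, trail] using h)]
  simp [lead, monomial_exponentOf]

theorem initialForm_five_of_eq
    (h : p.a12 + p.a32 + p.a12 = p.a31 + p.a41 + p.a23 + (p.a24 - p.a14)) :
    p.initialForm K 5 = X 1 ^ (p.a12 + p.a32 + p.a12) -
      X 0 ^ (p.a31 + p.a41) * X 2 ^ p.a23 * X 3 ^ (p.a24 - p.a14) := by
  rw [initialForm_of_eq K (by simpa [lead, trail] using h)]
  simp [lead, trail, monomial_exponentOf]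

/-- The weight equations of `f_1`, `f_3` and `f_5` imply the other four by linear combination. -/
theorem curveWeight_lead_eq_trail {n : Fin 4 → ℕ} (hle : p.a14 ≤ p.a24)
    (e1 : (p.a31 + p.a41) * n 0 = p.a12 * n 1 + p.a14 * n 3)
    (e3 : (p.a23 + p.a43) * n 2 = p.a31 * n 0 + p.a32 * n 1)
    (e5 : p.a31 * n 0 + p.a24 * n 3 = p.a12 * n 1 + p.a43 * n 2) (i : Fin 7) :
    curveWeight n (p.lead i) = curveWeight n (p.trail i) := by
  obtain ⟨k, hk⟩ := Nat.exists_eq_add_of_le hle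
  rw [hk] at e5
  fin_cases i <;> simp [lead, trail, curveWeight_exponentOf, hk] <;> linarith

/-- The signs arise because `f_1`, `f_2` and `f_7` are written with the leading monomial second. -/
theorem forall_eq_or_eq_neg_binomial :
    ∀ f ∈ ({X 0 ^ (p.a31 + p.a41) - X 1 ^ p.a12 * X 3 ^ p.a14,
      X 1 ^ (p.a12 + p.a32) - X 2 ^ p.a23 * X 3 ^ p.a24,
      X 2 ^ (p.a23 + p.a43) - X 0 ^ p.a31 * X 1 ^ p.a32,
      X 3 ^ (p.a14 + p.a24) - X 0 ^ p.a41 * X 2 ^ p.a43,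
      X 0 ^ p.a31 * X 3 ^ p.a24 - X 1 ^ p.a12 * X 2 ^ p.a43,
      X 1 ^ (p.a12 + p.a32 + p.a12) - X 0 ^ (p.a31 + p.a41) * X 2 ^ p.a23 * X 3 ^ (p.a24 - p.a14),
      X 0 ^ (p.a31 + p.a41 + p.a31) * X 3 ^ (p.a24 - p.a14) - X 1 ^ (2 * p.a12) * X 2 ^ p.a43} :
        Set (MvPolynomial (Fin 4) K)), ∃ i, f = p.binomial K i ∨ f = -p.binomial K i := by
  rw [binomial_eq]
  rintro f (rfl | rfl | rfl | rfl | rfl | rfl | rfl)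
  · exact ⟨0, .inr (neg_sub _ _).symm⟩
  · exact ⟨1, .inr (neg_sub _ _).symm⟩
  · exact ⟨2, .inl rfl⟩
  · exact ⟨3, .inl rfl⟩
  · exact ⟨4, .inl rfl⟩
  · exact ⟨5, .inl rfl⟩
  · exact ⟨6, .inr (neg_sub _ _).symm⟩

theorem binomial_mem_or_neg_binomial_mem (i : Fin 7) :
    let G : Set (MvPolynomial (Fin 4) K) := {X 0 ^ (p.a31 + p.a41) - X 1 ^ p.a12 * X 3 ^ p.a14,
      X 1 ^ (p.a12 + p.a32) - X 2 ^ p.a23 * X 3 ^ p.a24,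
      X 2 ^ (p.a23 + p.a43) - X 0 ^ p.a31 * X 1 ^ p.a32,
      X 3 ^ (p.a14 + p.a24) - X 0 ^ p.a41 * X 2 ^ p.a43,
      X 0 ^ p.a31 * X 3 ^ p.a24 - X 1 ^ p.a12 * X 2 ^ p.a43,
      X 1 ^ (p.a12 + p.a32 + p.a12) - X 0 ^ (p.a31 + p.a41) * X 2 ^ p.a23 * X 3 ^ (p.a24 - p.a14),
      X 0 ^ (p.a31 + p.a41 + p.a31) * X 3 ^ (p.a24 - p.a14) - X 1 ^ (2 * p.a12) * X 2 ^ p.a43}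
    p.binomial K i ∈ G ∨ -p.binomial K i ∈ G := by
  intro G
  rw [binomial_eq]
  fin_cases i
  · exact .inr (.inl (neg_sub _ _))
  · exact .inr (.inr (.inl (neg_sub _ _)))
  · exact .inl (.inr (.inr (.inl rfl)))
  · exact .inl (.inr (.inr (.inr (.inl rfl))))
  · exact .inl (.inr (.inr (.inr (.inr (.inl rfl)))))
  · exact .inl (.inr (.inr (.inr (.inr (.inr (.inl rfl))))))
  · exact .inr (.inr (.inr (.inr (.inr (.inr (.inr (neg_sub _ _)))))))

/-- If the toric ideal is generated by some of the binomials of the rewriting system, up to sign,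
then every polynomial in it has vanishing normal form. -/
theorem IsAdmissible.exists_normalForm (hp : p.IsAdmissible) {n : Fin 4 → ℕ} (hn : ∀ i, 0 < n i)
    (hw : ∀ i, curveWeight n (p.lead i) = curveWeight n (p.trail i))
    {S : Set (MvPolynomial (Fin 4) K)} {I : Ideal (MvPolynomial (Fin 4) K)}
    (hI : Ideal.span S = I) (hS : ∀ f ∈ S, ∃ i, f = p.binomial K i ∨ f = -p.binomial K i) :
    ∃ nf, (∀ α, Relation.ReflTransGen (RewriteStep p.lead p.trail) α (nf α)) ∧
      ∀ f ∈ I, normalFormMap K nf f = 0 := by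
  subst hI
  choose nf hnf hirr using exists_irreducible_reflTransGen (curveWeight n)
    (degree_le_curveWeight hn) hp.degreeThenExponentLT hw
  refine ⟨nf, hnf, fun f hf => normalFormMap_eq_zero (l := p.lead) (t := p.trail) ?_ ?_ hf⟩
  · simpa only [binomial, neg_sub] using hS
  · exact fun α β =>
      normalForm_eq_of_rewriteStep (p.strongly_confluent hp.le) hnf hirr

theorem IsAdmissible.isStandardBasis (hp : p.IsAdmissible)
    {nf : (Fin 4 →₀ ℕ) → Fin 4 →₀ ℕ}
    (hnf : ∀ α, Relation.ReflTransGen (RewriteStep p.lead p.trail) α (nf α))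
    {I : Ideal (MvPolynomial (Fin 4) K)} (hI : ∀ f ∈ I, normalFormMap K nf f = 0)
    (hmem : ∀ i, p.binomial K i ∈ I) {G : Set (MvPolynomial (Fin 4) K)}
    (hG : ∀ f ∈ G, ∃ i, f = p.binomial K i ∨ f = -p.binomial K i)
    (hG' : ∀ i, p.binomial K i ∈ G ∨ -p.binomial K i ∈ G) (hfin : G.Finite) :
    IsStandardBasis G I := by
  refine ⟨hfin, fun g hg => ?_, fun f hf hf0 => ?_⟩
  · obtain ⟨i, rfl | rfl⟩ := hG g hg
    · exact hmem i
    · exact I.neg_mem (hmem i)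
  · obtain ⟨α, hα⟩ := exists_isLeadingExponent hf0
    obtain ⟨i, hi⟩ := exists_le_of_isLeadingExponent hp.degreeThenExponentLT hnf (hI f hf) hα
    have hlead : IsLeadingExponent (p.binomial K i) (p.lead i) :=
      isLeadingExponent_binomial (hp.degreeThenExponentLT i)
    rcases hG' i with h | h
    · exact ⟨_, h, α, _, hα, hlead, hi⟩
    · exact ⟨_, h, α, _, hα, hlead.neg, hi⟩

end CurveExponents

end MonomialCurve

theorem theorem3p7 {K : Type*} [Field K]
    -- the curve `x_i = t ^ n_i`; `x_1, x_2, x_3, x_4` are `X 0, X 1, X 2, X 3`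
    (n : Fin 4 → ℕ) (hpos : 0 < n 0) (hmono : StrictMono n) (hgcd : Finset.univ.gcd n = 1)
    (a1 a2 a3 a4 a12 a14 a23 a24 a31 a32 a41 a43 : ℕ)
    -- `I(C)` is given as in case 3(b)
    (h12 : 0 < a12 ∧ a12 < a2) (h14 : 0 < a14 ∧ a14 < a4)
    (h23 : 0 < a23 ∧ a23 < a3) (h24 : 0 < a24 ∧ a24 < a4)
    (h31 : 0 < a31 ∧ a31 < a1) (h32 : 0 < a32 ∧ a32 < a2)
    (h41 : 0 < a41 ∧ a41 < a1) (h43 : 0 < a43 ∧ a43 < a3)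
    (hI : MonomialCurve.IsMinimallyGeneratedBy (MonomialCurve.toricIdeal K n)
      {X 0 ^ a1 - X 1 ^ a12 * X 3 ^ a14,
       X 1 ^ a2 - X 2 ^ a23 * X 3 ^ a24,
       X 2 ^ a3 - X 0 ^ a31 * X 1 ^ a32,
       X 3 ^ a4 - X 0 ^ a41 * X 2 ^ a43,
       X 0 ^ a31 * X 3 ^ a24 - X 1 ^ a12 * X 2 ^ a43})
    (hlt : a31 + a24 < a12 + a43)
    (hle : a14 ≤ a24)
    (hdeg : a2 + a12 ≤ a1 + a23 + (a24 - a14)) :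
    -- the standard basis `f_1, …, f_7` of `I(C)`
    MonomialCurve.IsStandardBasis
      {X 0 ^ a1 - X 1 ^ a12 * X 3 ^ a14,
       X 1 ^ a2 - X 2 ^ a23 * X 3 ^ a24,
       X 2 ^ a3 - X 0 ^ a31 * X 1 ^ a32,
       X 3 ^ a4 - X 0 ^ a41 * X 2 ^ a43,
       X 0 ^ a31 * X 3 ^ a24 - X 1 ^ a12 * X 2 ^ a43,
       X 1 ^ (a2 + a12) - X 0 ^ a1 * X 2 ^ a23 * X 3 ^ (a24 - a14),
       X 0 ^ (a1 + a31) * X 3 ^ (a24 - a14) - X 1 ^ (2 * a12) * X 2 ^ a43}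
      (MonomialCurve.toricIdeal K n) ∧
    -- minimal generators of `I(C)_*`, strict case
    (a2 + a12 < a1 + a23 + (a24 - a14) →
      MonomialCurve.IsMinimallyGeneratedBy
        (MonomialCurve.tangentConeIdeal (MonomialCurve.toricIdeal K n))
        {X 1 ^ a12 * X 3 ^ a14,
         X 2 ^ a23 * X 3 ^ a24,
         X 2 ^ a3,
         X 3 ^ a4,
         X 0 ^ a31 * X 3 ^ a24,
         X 1 ^ (a2 + a12),
         X 1 ^ (2 * a12) * X 2 ^ a43}) ∧
    -- minimal generators of `I(C)_*`, case of equality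
    (a2 + a12 = a1 + a23 + (a24 - a14) →
      MonomialCurve.IsMinimallyGeneratedBy
        (MonomialCurve.tangentConeIdeal (MonomialCurve.toricIdeal K n))
        {X 1 ^ a12 * X 3 ^ a14,
         X 2 ^ a23 * X 3 ^ a24,
         X 2 ^ a3,
         X 3 ^ a4,
         X 0 ^ a31 * X 3 ^ a24,
         X 1 ^ (a2 + a12) - X 0 ^ a1 * X 2 ^ a23 * X 3 ^ (a24 - a14),
         X 1 ^ (2 * a12) * X 2 ^ a43}) ∧
    -- the minimal number of generators of `I(C)_*` is seven
    (MonomialCurve.tangentConeIdeal (MonomialCurve.toricIdeal K n)).spanFinrank = 7 := by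
  have hn (i : Fin 4) : 0 < n i := hpos.trans_le (hmono.monotone (Fin.zero_le i))
  obtain ⟨rfl, rfl, rfl, rfl, e1, e2, e3, e4, e5⟩ :=
    MonomialCurve.exponent_relations hn h12 h14 h23 h24 h31 h32 h41 h43 hI
  have n01 : n 0 < n 1 := hmono (by decide)
  have n12 : n 1 < n 2 := hmono (by decide)
  have n23 : n 2 < n 3 := hmono (by decide)
  obtain ⟨p, rfl, rfl, rfl, rfl, rfl, rfl, rfl, rfl⟩ : ∃ p : MonomialCurve.CurveExponents,
      a12 = p.a12 ∧ a14 = p.a14 ∧ a23 = p.a23 ∧ a24 = p.a24 ∧ a31 = p.a31 ∧ a32 = p.a32 ∧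
      a41 = p.a41 ∧ a43 = p.a43 :=
    ⟨⟨a12, a14, a23, a24, a31, a32, a41, a43⟩, rfl, rfl, rfl, rfl, rfl, rfl, rfl, rfl⟩
  have hp : p.IsAdmissible :=
    { pos := ⟨h12.1, h14.1, h23.1, h24.1, h31.1, h32.1, h41.1, h43.1⟩
      le := hle
      degree_one := MonomialCurve.add_lt_of_mul_eq h12.1 n01 (n01.trans (n12.trans n23)) e1
      degree_two := MonomialCurve.add_lt_of_mul_eq h23.1 n12 (n12.trans n23) e2
      degree_three := MonomialCurve.lt_add_of_mul_eq h31.1 (n01.trans n12) n12 e3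
      degree_four := MonomialCurve.lt_add_of_mul_eq h41.1 (n01.trans (n12.trans n23)) n23 e4
      degree_five := hlt
      degree_six := hdeg }
  have hw := MonomialCurve.CurveExponents.curveWeight_lead_eq_trail (p := p) hle e1 e3 e5
  have hb := fun i => MonomialCurve.binomial_mem_toricIdeal_iff (K := K).mpr (hw i)
  have hG := MonomialCurve.CurveExponents.forall_eq_or_eq_neg_binomial (p := p) (K := K)
  -- The ideal is generated by the first five of the seven polynomials, all of which are rules up to
  -- sign.
  obtain ⟨nf, hnf, hzero⟩ := hp.exists_normalForm hn hw hI.1 fun f hf => hG f (by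
    rcases hf with h | h | h | h | h
    · exact .inl h
    · exact .inr (.inl h)
    · exact .inr (.inr (.inl h))
    · exact .inr (.inr (.inr (.inl h)))
    · exact .inr (.inr (.inr (.inr (.inl h)))))
  have hcone : MonomialCurve.tangentConeIdeal (MonomialCurve.toricIdeal K n) =
      Ideal.span (Set.range (p.initialForm K)) :=
    MonomialCurve.tangentConeIdeal_eq hp.lead_ne_trail hp.degree_le hnf hb hzero
  have hmin := MonomialCurve.isMinimallyGeneratedBy_span_range
    (hp.eq_of_mem_support_initialForm K) (hp.coeff_lead_initialForm K)
  rw [← hcone] at hmin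
  refine ⟨?_, fun h => ?_, fun h => ?_, ?_⟩
  · exact hp.isStandardBasis hnf hzero hb hG
      MonomialCurve.CurveExponents.binomial_mem_or_neg_binomial_mem (Set.toFinite _)
  · rwa [MonomialCurve.CurveExponents.range_initialForm hp,
      MonomialCurve.CurveExponents.initialForm_five_of_lt h] at hmin
  · rwa [MonomialCurve.CurveExponents.range_initialForm hp,
      MonomialCurve.CurveExponents.initialForm_five_of_eq h] at hmin
  · rw [hcone, MonomialCurve.spanFinrank_span_range
      (hp.eq_of_mem_support_initialForm K) (hp.coeff_lead_initialForm K), Fintype.card_fin]
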